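/- **Setting.** Let $\Theta\subseteq\mathbb R^k$, let $\{f(\cdot,\theta):\theta\in\Theta\}$ be a parametric family of Lebesgue probability densities on $\mathbb R^n$, and for $t\in\mathbb Z$, $\theta\in\Theta$ let $\varepsilon_t(\theta)$ be an $\mathbb R^n$-valued random vector (the residual at time $t$ and parameter $\theta$), all on one probability space. Put $l_t(\theta)=\log f(\varepsilon_t(\theta),\theta)$, $L_T(\theta)=\frac1T\sum_{t=1}^T l_t(\theta)$; let $l_{\theta,t}(\theta)\in\mathbb R^k$ (the score) and $l_{\theta\theta,t}(\theta)\in\mathbb R^{k\times k}$ be the gradient and the Hessian of $\theta\mapsto l_t(\theta)$, and $L_{\theta,T}$ the gradient of $L_T$. Let $\theta_0\in\Theta$, let $\hat\theta_T$ ($T\ge 1$) be $\Theta$-valued random vectors, let $U\subseteq\Theta$ be an open neighbourhood of $\theta_0$, and let $\Theta_0\subseteq U$ be a non-singleton compact set with $\theta_0$ in its interior. Assume: 1. $\theta_0$ is an interior point of $\Theta$, $\hat\theta_T\to\theta_0$ almost surely, and $L_{\theta,T}(\hat\theta_T)=o_P(T^{-1/2})$. 2. The residual process $(\varepsilon_t)_{t\in\mathbb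 Z}$, $\varepsilon_t=(\varepsilon_t(\theta))_{\theta\in\Theta}$, is strictly stationary and ergodic (jointly in $\theta$), and $\varepsilon_t(\theta_0)$ has density $f(\cdot,\theta_0)$. 3. The score at $\theta_0$, $(l_{\theta,t}(\theta_0))_t$, is a martingale difference sequence with respect to some filtration. 4. $f(x,\theta)>0$ for all $x\in\mathbb R^n$, $\theta\in\Theta$; for all $x$, $f(x,\cdot)$ is twice continuously differentiable on $U$; and almost surely every $l_t(\cdot)$ is twice continuously differentiable on $U$. 5. $\mathbb E\|l_{\theta,t}(\theta_0)\|^2<\infty$. 6. $\mathbb E\sup_{\theta\in\Theta_0}\|l_{\theta\theta,t}(\theta)\|<\infty$. 7. $\mathbb E\,l_{\theta\theta,t}(\theta_0)$ is non-singular. 8. $\mathbb E\,l_{\theta\theta,t}(\theta_0)=-\mathbb E[l_{\theta,t}(\theta_0)l_{\theta,t}(\theta_0)']$. In addition, assume $\mathbb E\sup_{\theta\in\Theta_0}\|l_{\theta,t}(\theta)\|^2<\infty$. **Theorem 3.** The matrix $M(\theta)=\mathbb E[l_{\theta,t}(\theta)l_{\theta,t}(\theta)']$ is well defined (finite and independent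 of $t$) for every $\theta\in\Theta_0$, and $$B_T=\frac1T\sum_{t=1}^T l_{\theta,t}(\hat\theta_T)\,l_{\theta,t}(\hat\theta_T)'\ \xrightarrow{\ p\ }\ M(\theta_0).$$ Moreover: * $B_T-M(\hat\theta_T)\xrightarrow{p}0$, where $M(\hat\theta_T)$ is the function $\theta\mapsto\mathbb E[l_{\theta,t}(\theta)l_{\theta,t}(\theta)']$ evaluated at $\theta=\hat\theta_T$. * If, for all large $T$, $\hat\theta_T\in\Theta_0$ almost surely, then for every fixed $t$ the expectation $\mathbb E[l_{\theta,t}(\hat\theta_T)l_{\theta,t}(\hat\theta_T)']$, with the random $\hat\theta_T$ inside, is finite for all large $T$ and $B_T-\mathbb E[l_{\theta,t}(\hat\theta_T)l_{\theta,t}(\hat\theta_T)']\xrightarrow{p}0$. * $M(\theta_0)$ is non-singular and $B_T^{-1}\xrightarrow{p}M(\theta_0)^{-1}$, that is, $B_T^{-1}$ is a consistent estimator of the matrix $M(\theta_0)^{-1}$, the asymptotic covariance matrix of the estimator (the covariance matrix of the limit $\mathcal N(0,M(\theta_0)^{-1})$ of $\sqrt T(\hat\theta_T-\theta_0)$; that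 asymptotic normality is a separate result and not part of this claim). (Matrix inverses are set to $0$ where $B_T$ is singular.) -/

import Mathlib

open MeasureTheory ProbabilityTheory Filter Topology
open scoped ENNReal

attribute [local instance] Matrix.frobeniusNormedAddCommGroup

noncomputable section

namespace GenericMLE

/-- The two-sided process `X` is (strictly) stationary and ergodic under `μ`: the one-step shift on
the path space `ℤ → S` preserves the law of the path and is ergodic for it. -/
def IsStationaryErgodic {Ω S : Type*} [MeasurableSpace Ω] [MeasurableSpace S]
    (X : ℤ → Ω → S) (μ : Measure Ω) : Prop :=
  (∀ t, Measurable (X t)) ∧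
    Ergodic (fun (x : ℤ → S) (t : ℤ) => x (t + 1)) (μ.map (fun ω t => X t ω))

/-- `s` is a martingale difference sequence with respect to the filtration `ℱ`. -/
def IsMartingaleDifference {Ω E : Type*} [mΩ : MeasurableSpace Ω]
    [NormedAddCommGroup E] [NormedSpace ℝ E] [CompleteSpace E]
    (s : ℤ → Ω → E) (ℱ : Filtration ℤ mΩ) (μ : Measure Ω) : Prop :=
  StronglyAdapted ℱ s ∧ (∀ t, Integrable (s t) μ) ∧ ∀ t, μ[s t | ℱ (t - 1)] =ᵐ[μ] 0

/-- `f x θ`, `θ ∈ Θ`, is a parametric family of (Lebesgue) probability densities on `ℝⁿ`. -/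
def IsDensityFamily {n k : ℕ}
    (f : EuclideanSpace ℝ (Fin n) → EuclideanSpace ℝ (Fin k) → ℝ)
    (Θ : Set (EuclideanSpace ℝ (Fin k))) : Prop :=
  ∀ θ ∈ Θ, Measurable (fun x => f x θ) ∧ (∀ x, 0 ≤ f x θ) ∧ ∫⁻ x, ENNReal.ofReal (f x θ) = 1

/-- The Hessian matrix of `g` at `θ`: the entry `(i, j)` is `∂_j ∂_i g (θ)`. -/
def hessian {k : ℕ} (g : EuclideanSpace ℝ (Fin k) → ℝ) (θ : EuclideanSpace ℝ (Fin k)) :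
    Matrix (Fin k) (Fin k) ℝ :=
  Matrix.of fun i j => fderiv ℝ (fun η => gradient g η i) θ (EuclideanSpace.single j 1)

/-- The outer product `v v'`. -/
def outer {k : ℕ} (v : EuclideanSpace ℝ (Fin k)) : Matrix (Fin k) (Fin k) ℝ :=
  Matrix.of fun i j => v i * v j

/-- The expectation of a random matrix, taken entry by entry. -/
def matrixMean {Ω : Type*} [MeasurableSpace Ω] {k : ℕ} (μ : Measure Ω)
    (A : Ω → Matrix (Fin k) (Fin k) ℝ) : Matrix (Fin k) (Fin k) ℝ :=
  Matrix.of fun i j => ∫ ω, A ω i j ∂μ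

/-- Integrability of a random matrix, entry by entry. -/
def MatrixIntegrable {Ω : Type*} [MeasurableSpace Ω] {k : ℕ} (μ : Measure Ω)
    (A : Ω → Matrix (Fin k) (Fin k) ℝ) : Prop :=
  ∀ i j, Integrable (fun ω => A ω i j) μ

/-- Convergence in probability of random matrices, entry by entry. -/
def TendstoInProbability {Ω : Type*} [MeasurableSpace Ω] {k : ℕ} (μ : Measure Ω)
    (A : ℕ → Ω → Matrix (Fin k) (Fin k) ℝ) (A₀ : Matrix (Fin k) (Fin k) ℝ) : Prop :=
  ∀ i j, TendstoInMeasure μ (fun T ω => A T ω i j) atTop (fun _ => A₀ i j)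

section Likelihood

variable {Ω : Type*} {n k : ℕ}
  (f : EuclideanSpace ℝ (Fin n) → EuclideanSpace ℝ (Fin k) → ℝ)
  (ε : ℤ → EuclideanSpace ℝ (Fin k) → Ω → EuclideanSpace ℝ (Fin n))

/-- The contribution `l_t(θ) = log f(ε_t(θ), θ)` to the log-likelihood. -/
def contribution (t : ℤ) (ω : Ω) (θ : EuclideanSpace ℝ (Fin k)) : ℝ :=
  Real.log (f (ε t θ ω) θ)

/-- The standardized log-likelihood `L_T(θ) = T⁻¹ ∑_{t=1}^T l_t(θ)`. -/
def logLikelihood (T : ℕ) (ω : Ω) (θ : EuclideanSpace ℝ (Fin k)) : ℝ :=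
  (T : ℝ)⁻¹ * ∑ t ∈ Finset.Icc 1 T, contribution f ε (t : ℤ) ω θ

/-- The score of the `t`-th contribution: the gradient of `l_t` at `θ`. -/
def score (t : ℤ) (ω : Ω) (θ : EuclideanSpace ℝ (Fin k)) : EuclideanSpace ℝ (Fin k) :=
  gradient (contribution f ε t ω) θ

/-- The Hessian of the `t`-th contribution at `θ`. -/
def scoreHessian (t : ℤ) (ω : Ω) (θ : EuclideanSpace ℝ (Fin k)) : Matrix (Fin k) (Fin k) ℝ :=
  hessian (contribution f ε t ω) θ

/-- The average outer product of the scores, `T⁻¹ ∑_{t=1}^T l_{θ,t}(θ) l_{θ,t}(θ)'`. -/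
def scoreOPG (T : ℕ) (ω : Ω) (θ : EuclideanSpace ℝ (Fin k)) : Matrix (Fin k) (Fin k) ℝ :=
  (T : ℝ)⁻¹ • ∑ t ∈ Finset.Icc 1 T, outer (score f ε (t : ℤ) ω θ)

/-- The expected outer product of the score at the fixed parameter `θ`. -/
def expectedOPG [MeasurableSpace Ω] (μ : Measure Ω) (t : ℤ) (θ : EuclideanSpace ℝ (Fin k)) :
    Matrix (Fin k) (Fin k) ℝ :=
  matrixMean μ (fun ω => outer (score f ε t ω θ))

end Likelihood

end GenericMLE

end

/-! Near `θ₀`, each entry of the outer product of the scores is a measurable functional `g θ` of the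
residual path, almost surely continuous in `θ` and dominated over `Θ₀` by an integrable function,
the squared supremum of the score. Everything then follows from a law of large numbers for a
stationary ergodic process evaluated at a consistent estimator.

At a fixed parameter this law comes from von Neumann's mean ergodic theorem: averages converge in L²
to the projection onto the shift-invariant functions, which ergodicity makes constant. Density of L²
and contractivity of averaging carry this to L¹. At the estimator, replacing `θ₀` costs at most the
average of an oscillation modulus `D m` over a small neighbourhood of `θ₀`; its expectation tends to
zero by dominated convergence, so Markov's inequality controls it (`exists_modulus`,
`tendstoInMeasure_average_estimator`).

Dominated convergence also makes the expected outer product continuous at `θ₀`, and handles the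
expectation with the estimator inside. The information matrix equality turns non-singularity of the
Hessian into that of the limit, and inversion is continuous there. -/

namespace GenericMLE

/-! ### Mean ergodic theorem in L² and L¹. -/

section MeanErgodic

variable {α : Type*} [MeasurableSpace α] {ν : Measure α} {τ : α → α} {g : α → ℝ}

theorem coeFn_birkhoffAverage_compMeasurePreserving (hτ : MeasurePreserving τ ν ν)
    (hg : MemLp g 2 ν) (N : ℕ) :
    ((birkhoffAverage ℝ (Lp.compMeasurePreserving τ hτ) id N (hg.toLp g) : Lp ℝ 2 ν) : α → ℝ) =ᵐ[ν]
      fun x => birkhoffAverage ℝ τ g N x := by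
  have hsum : ∀ N : ℕ, ((birkhoffSum (Lp.compMeasurePreserving τ hτ) id N (hg.toLp g) : Lp ℝ 2 ν) : α → ℝ) =ᵐ[ν]
      fun x => birkhoffSum τ g N x := by
    intro N
    induction N with
    | zero =>
      simp only [birkhoffSum_zero]
      exact Lp.coeFn_zero _ _ _
    | succ N ih =>
      simp only [birkhoffSum_succ]
      refine (Lp.coeFn_add _ _).trans (ih.add ?_)
      rw [id, Lp.compMeasurePreserving_iterate, Lp.toLp_compMeasurePreserving]
      exact MemLp.coeFn_toLp _
  simp only [birkhoffAverage]
  filter_upwards [Lp.coeFn_smul ((N : ℝ)⁻¹)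
    (birkhoffSum (Lp.compMeasurePreserving τ hτ) id N (hg.toLp g)), hsum N] with x hx hx'
  rw [hx, Pi.smul_apply, hx']

theorem tendsto_eLpNorm_two_birkhoffAverage_sub_integral [IsProbabilityMeasure ν]
    (hτ : Ergodic τ ν) (hg : MemLp g 2 ν) :
    Tendsto (fun N => eLpNorm (fun x => birkhoffAverage ℝ τ g N x - ∫ y, g y ∂ν) 2 ν) atTop
      (𝓝 0) := by
  set K : Lp ℝ 2 ν →ₗᵢ[ℝ] Lp ℝ 2 ν := Lp.compMeasurePreservingₗᵢ ℝ τ hτ.toMeasurePreserving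
  set F := K.toContinuousLinearMap.eqLocus (1 : Lp ℝ 2 ν →L[ℝ] Lp ℝ 2 ν)
  have hlim := K.toContinuousLinearMap.tendsto_birkhoffAverage_orthogonalProjection
    K.norm_toContinuousLinearMap_le (hg.toLp g)
  set P : Lp ℝ 2 ν := ((F.orthogonalProjectionOnto (hg.toLp g) : F) : Lp ℝ 2 ν)
  have hPF : P ∈ F := (F.orthogonalProjectionOnto (hg.toLp g)).2
  -- Ergodicity enters here: a function fixed by the Koopman operator is almost surely constant.
  obtain ⟨c, hc⟩ : ∃ c : ℝ, (P : α → ℝ) =ᵐ[ν] Function.const α c := by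
    refine hτ.ae_eq_const_of_ae_eq_comp_ae (Lp.aestronglyMeasurable P) ?_
    have h1 : Lp.compMeasurePreserving τ hτ.toMeasurePreserving P = P := hPF
    exact (Lp.coeFn_compMeasurePreserving P hτ.toMeasurePreserving).symm.trans (by rw [h1])
  have hone : MemLp (fun _ : α => (1 : ℝ)) 2 ν := memLp_const 1
  have h1F : hone.toLp _ ∈ F := by
    change Lp.compMeasurePreserving τ hτ.toMeasurePreserving (hone.toLp _) = hone.toLp _
    rw [Lp.toLp_compMeasurePreserving]
    rfl
  -- The constant 1 is invariant and `g - P` is orthogonal to all invariant functions; pairing the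
  -- two gives the value of `c`.
  have hcint : c = ∫ y, g y ∂ν := by
    have h0 : inner ℝ (hone.toLp _) (hg.toLp g - P) = 0 :=
      (Submodule.mem_orthogonal _ _).1 (F.sub_starProjection_mem_orthogonal _) _ h1F
    rw [L2.inner_def] at h0
    have h2 : (fun a => inner ℝ ((hone.toLp _ : Lp ℝ 2 ν) a) ((hg.toLp g - P : Lp ℝ 2 ν) a))
        =ᵐ[ν] fun a => g a - c := by
      filter_upwards [hone.coeFn_toLp, Lp.coeFn_sub (hg.toLp g) P, hg.coeFn_toLp, hc]
        with a h1 h2 h3 h4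
      rw [h1, h2, Pi.sub_apply, h3, h4]
      simp
    rw [integral_congr_ae h2, integral_sub (hg.integrable (by norm_num)) (integrable_const _)] at h0
    simp at h0
    linarith
  have h3 : Tendsto (fun N => eLpNorm
      ((birkhoffAverage ℝ K id N (hg.toLp g) : Lp ℝ 2 ν) - P : α → ℝ) 2 ν) atTop (𝓝 0) :=
    (Lp.tendsto_Lp_iff_tendsto_eLpNorm' _ _).1 hlim
  refine h3.congr fun N => eLpNorm_congr_ae ?_
  filter_upwards [coeFn_birkhoffAverage_compMeasurePreserving hτ.toMeasurePreserving hg N, hc]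
    with x hx hx'
  rw [Pi.sub_apply, hx', ← hcint]
  exact congrArg (· - c) hx

theorem eLpNorm_one_birkhoffAverage_le (hτ : MeasurePreserving τ ν ν)
    (hg : AEStronglyMeasurable g ν) (N : ℕ) :
    eLpNorm (fun x => birkhoffAverage ℝ τ g N x) 1 ν ≤ eLpNorm g 1 ν := by
  have hsum : ∀ N : ℕ, eLpNorm (birkhoffSum τ g N) 1 ν ≤ N * eLpNorm g 1 ν := by
    intro N
    have : birkhoffSum τ g N = ∑ n ∈ Finset.range N, g ∘ τ^[n] := by
      ext x; simp [birkhoffSum]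
    rw [this]
    refine (eLpNorm_sum_le (fun n _ => hg.comp_measurePreserving (hτ.iterate n)) le_rfl).trans ?_
    simp [eLpNorm_comp_measurePreserving hg (hτ.iterate _)]
  have : (fun x => birkhoffAverage ℝ τ g N x) = (N : ℝ)⁻¹ • birkhoffSum τ g N := rfl
  rw [this, eLpNorm_const_smul]
  rcases N.eq_zero_or_pos with rfl | hN
  · simp
  refine (mul_le_mul_right (hsum N) _).trans ?_
  rw [← mul_assoc, enorm_inv (by positivity)]
  simp only [Real.enorm_natCast]
  rw [ENNReal.inv_mul_cancel (by positivity) (by simp), one_mul]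

/-- Simple functions lie in L² and are dense in L¹. Averaging is an L¹ contraction, so the
approximation error stays small uniformly in `N`. -/
theorem tendsto_eLpNorm_one_birkhoffAverage_sub_integral [IsProbabilityMeasure ν]
    (hτ : Ergodic τ ν) (hg : Integrable g ν) :
    Tendsto (fun N => eLpNorm (fun x => birkhoffAverage ℝ τ g N x - ∫ y, g y ∂ν) 1 ν) atTop
      (𝓝 0) := by
  rw [ENNReal.tendsto_nhds_zero]
  intro ε hε
  have hε3 : ε / 3 ≠ 0 := by simpa using hε.ne'
  obtain ⟨φ, hφ, hφ1⟩ := (memLp_one_iff_integrable.2 hg).exists_simpleFunc_eLpNorm_sub_lt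
    ENNReal.one_ne_top hε3
  have hφ2 : MemLp φ 2 ν := φ.memLp_of_isFiniteMeasure 2 ν
  generalize (φ : α → ℝ) = φ at hφ hφ1 hφ2
  have hav : ∀ (h : α → ℝ), AEStronglyMeasurable h ν → ∀ N,
      AEStronglyMeasurable (fun x => birkhoffAverage ℝ τ h N x) ν := by
    intro h hh N
    have : (fun x => birkhoffAverage ℝ τ h N x)
        = (N : ℝ)⁻¹ • ∑ n ∈ Finset.range N, h ∘ τ^[n] := by
      ext x; simp [birkhoffAverage, birkhoffSum]
    rw [this]
    exact (Finset.aestronglyMeasurable_sum _ fun n _ =>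
      hh.comp_measurePreserving (hτ.toMeasurePreserving.iterate n)).const_smul _
  filter_upwards [(ENNReal.tendsto_nhds_zero.1
    (tendsto_eLpNorm_two_birkhoffAverage_sub_integral hτ hφ2)) (ε / 3) (by positivity)] with N hN
  have hgφ := hg.aestronglyMeasurable.sub hφ2.aestronglyMeasurable
  -- Three errors of at most `ε / 3` each: averaging `g - φ`, the ergodic error for `φ`, and the
  -- difference of the means.
  have hdecomp : (fun x => birkhoffAverage ℝ τ g N x - ∫ y, g y ∂ν) =
      ((fun x => birkhoffAverage ℝ τ (g - φ) N x) +
        fun x => birkhoffAverage ℝ τ φ N x - ∫ y, φ y ∂ν) + fun _ => ∫ y, (φ - g) y ∂ν := by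
    ext x
    simp only [Pi.add_apply, Pi.sub_apply]
    rw [integral_sub (hφ2.integrable (by norm_num)) hg]
    simp only [birkhoffAverage, birkhoffSum, Pi.sub_apply, Finset.sum_sub_distrib, smul_eq_mul]
    ring
  rw [hdecomp]
  have h12 := (hav φ hφ2.aestronglyMeasurable N).sub
    (aestronglyMeasurable_const (b := ∫ y, φ y ∂ν) (μ := ν))
  calc _ ≤ (eLpNorm (fun x => birkhoffAverage ℝ τ (g - φ) N x) 1 ν +
        eLpNorm (fun x => birkhoffAverage ℝ τ φ N x - ∫ y, φ y ∂ν) 1 ν) +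
        eLpNorm (fun _ => ∫ y, (φ - g) y ∂ν) 1 ν := by
        refine (eLpNorm_add_le ((hav _ hgφ N).add h12) aestronglyMeasurable_const le_rfl).trans ?_
        gcongr
        exact eLpNorm_add_le (hav _ hgφ N) h12 le_rfl
    _ ≤ ε / 3 + ε / 3 + ε / 3 := by
        gcongr
        · exact (eLpNorm_one_birkhoffAverage_le hτ.toMeasurePreserving hgφ N).trans hφ.le
        · exact (eLpNorm_le_eLpNorm_of_exponent_le (by norm_num) h12).trans hN
        · rw [eLpNorm_const _ one_ne_zero (IsProbabilityMeasure.ne_zero ν)]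
          simp only [measure_univ, ENNReal.one_rpow, mul_one]
          refine (enorm_integral_le_lintegral_enorm _).trans ?_
          rw [← eLpNorm_one_eq_lintegral_enorm, eLpNorm_sub_comm]
          exact hφ.le
    _ = ε := ENNReal.add_thirds ε

end MeanErgodic

/-! ### Weak law of large numbers for stationary ergodic processes. -/

section Stationary

variable {Ω S : Type*} [MeasurableSpace Ω] [MeasurableSpace S] {μ : Measure Ω}
  {X : ℤ → Ω → S}

theorem IsStationaryErgodic.map_eq (hX : IsStationaryErgodic X μ) (s t : ℤ) :
    μ.map (X s) = μ.map (X t) := by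
  have hstep : ∀ t, μ.map (X (t + 1)) = μ.map (X t) := by
    intro t
    have hm : Measurable fun ω t => X t ω := measurable_pi_lambda _ hX.1
    have h := congrArg (Measure.map (fun x : ℤ → S => x t)) hX.2.toMeasurePreserving.map_eq
    rw [Measure.map_map (measurable_pi_apply t) hX.2.measurable,
      Measure.map_map ((measurable_pi_apply t).comp hX.2.measurable) hm,
      Measure.map_map (measurable_pi_apply t) hm] at h
    exact h
  have hall : ∀ t, μ.map (X t) = μ.map (X 0) := by
    intro t
    induction t using Int.induction_on with
    | zero => rfl
    | succ n ih => rw [hstep, ih]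
    | pred n ih => rw [← ih, ← hstep (-n - 1), sub_add_cancel]
  rw [hall s, hall t]

theorem IsStationaryErgodic.identDistrib (hX : IsStationaryErgodic X μ) (s t : ℤ) :
    IdentDistrib (X s) (X t) μ μ :=
  ⟨(hX.1 s).aemeasurable, (hX.1 t).aemeasurable, hX.map_eq s t⟩

/-- The weak law of large numbers for a stationary ergodic process. -/
theorem IsStationaryErgodic.tendstoInMeasure_average [IsProbabilityMeasure μ]
    (hX : IsStationaryErgodic X μ) {g : S → ℝ} (hg : Measurable g) (t : ℤ)
    (hint : Integrable (fun ω => g (X t ω)) μ) :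
    TendstoInMeasure μ (fun (T : ℕ) ω => (T : ℝ)⁻¹ * ∑ s ∈ Finset.Icc 1 T, g (X (s : ℤ) ω)) atTop
      (fun _ => ∫ ω, g (X t ω) ∂μ) := by
  set path : Ω → ℤ → S := fun ω t => X t ω
  have hm : Measurable path := measurable_pi_lambda _ hX.1
  set ν := μ.map path
  have : IsProbabilityMeasure ν := Measure.isProbabilityMeasure_map hm.aemeasurable
  set τ : (ℤ → S) → ℤ → S := fun x t => x (t + 1)
  have hτ : Ergodic τ ν := hX.2
  have hiter : ∀ (n : ℕ) (x : ℤ → S) (t : ℤ), τ^[n] x t = x (t + n) := by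
    intro n
    induction n with
    | zero => simp
    | succ n ih =>
      intro x t
      rw [Function.iterate_succ_apply, ih]
      simp only [τ]
      push_cast
      ring_nf
  have hid : IdentDistrib (fun ω => g (X 1 ω)) (fun ω => g (X t ω)) μ μ :=
    (hX.identDistrib 1 t).comp hg
  -- Reading coordinate 1 makes the shifts `0, …, N - 1` of the Birkhoff sum match the times `1, …,
  -- N`.
  have hGm : Measurable fun x : ℤ → S => g (x 1) := hg.comp (measurable_pi_apply 1)
  have hGint : Integrable (fun x : ℤ → S => g (x 1)) ν :=
    (integrable_map_measure hGm.aestronglyMeasurable hm.aemeasurable).2 (hid.integrable_iff.2 hint)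
  have hmean : ∫ x, g (x 1) ∂ν = ∫ ω, g (X t ω) ∂μ :=
    (integral_map hm.aemeasurable hGm.aestronglyMeasurable).trans hid.integral_eq
  have hlim := tendsto_eLpNorm_one_birkhoffAverage_sub_integral hτ hGint
  have havm : ∀ N, Measurable fun x => birkhoffAverage ℝ τ (fun x : ℤ → S => g (x 1)) N x := by
    intro N
    simp only [birkhoffAverage, birkhoffSum]
    exact (Finset.measurable_sum (Finset.range N) fun n _ =>
      hGm.comp (hτ.measurable.iterate n)).const_mul ((N : ℝ)⁻¹)
  have heq : ∀ N ω, birkhoffAverage ℝ τ (fun x : ℤ → S => g (x 1)) N (path ω) =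
      (N : ℝ)⁻¹ * ∑ s ∈ Finset.Icc 1 N, g (X (s : ℤ) ω) := by
    intro N ω
    simp only [birkhoffAverage, birkhoffSum, smul_eq_mul, hiter]
    congr 1
    rw [← Finset.Ico_add_one_right_eq_Icc, Finset.sum_Ico_eq_sum_range]
    simp [path]
  refine tendstoInMeasure_of_tendsto_eLpNorm one_ne_zero (fun N => ?_)
    aestronglyMeasurable_const ?_
  · simp only [← heq]
    exact ((havm N).comp hm).aestronglyMeasurable
  · refine hlim.congr fun N => ?_
    rw [eLpNorm_map_measure ((havm N).sub_const _).aestronglyMeasurable hm.aemeasurable, hmean]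
    refine congrArg (fun h => eLpNorm h 1 μ) ?_
    ext ω
    simp only [Function.comp_apply, Pi.sub_apply, heq]

end Stationary
end GenericMLE

namespace GenericMLE

/-! ### Laws of large numbers at an estimated parameter. -/

section UniformLaw

/-- This lets a supremum over a countable dense set, which is measurable, replace one over an
uncountable parameter set. -/
theorem enorm_le_iSup_of_mem_closure {E : Type*} [TopologicalSpace E] {h : E → ℝ} {K B : Set E}
    (hh : ContinuousOn h K) (hBK : B ⊆ K) {θ : E} (hθK : θ ∈ K) (hθ : θ ∈ closure B) :
    ‖h θ‖ₑ ≤ ⨆ η ∈ B, ‖h η‖ₑ := by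
  have : (𝓝[B] θ).NeBot := mem_closure_iff_nhdsWithin_neBot.1 hθ
  have hlim : Tendsto (fun η => ‖h η‖ₑ) (𝓝[B] θ) (𝓝 ‖h θ‖ₑ) :=
    ((hh θ hθK).mono hBK).enorm
  refine le_of_tendsto hlim ?_
  filter_upwards [self_mem_nhdsWithin] with η hη
  exact le_iSup₂_of_le η hη le_rfl

variable {Ω S E : Type*} [MeasurableSpace Ω] [MeasurableSpace S] {μ : Measure Ω}
  {X : ℤ → Ω → S} [PseudoMetricSpace E] [SecondCountableTopology E] {g : E → S → ℝ} {K : Set E}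
  {θ₀ : E}

theorem exists_countable_subset_subset_closure (K : Set E) :
    ∃ B ⊆ K, B.Countable ∧ K ⊆ closure B := by
  obtain ⟨B, hBK, hB, hK⟩ :=
    (TopologicalSpace.IsSeparable.of_separableSpace K).exists_countable_dense_subset
  exact ⟨B, hBK, hB, hK⟩

/-- The bound is a function of the state alone, so stationarity transfers its integrability from
time 0 to every time. -/
theorem IsStationaryErgodic.exists_dominating (hX : IsStationaryErgodic X μ)
    (hg : ∀ θ, Measurable (g θ))
    (hcont : ∀ᵐ ω ∂μ, ∀ t, ContinuousOn (fun θ => g θ (X t ω)) K)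
    (hdom : ∫⁻ ω, ⨆ θ ∈ K, ‖g θ (X 0 ω)‖ₑ ∂μ < ∞) :
    ∃ b : S → ℝ, Measurable b ∧ (∀ t, Integrable (fun ω => b (X t ω)) μ) ∧
      ∀ᵐ ω ∂μ, ∀ t, ∀ θ ∈ K, ‖g θ (X t ω)‖ ≤ b (X t ω) := by
  obtain ⟨B, hBK, hB, hKB⟩ := exists_countable_subset_subset_closure K
  set W : S → ℝ≥0∞ := fun y => ⨆ θ ∈ B, ‖g θ y‖ₑ
  have hW : Measurable W := Measurable.biSup B hB fun θ _ => (hg θ).enorm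
  have hWint : ∀ t, ∫⁻ ω, W (X t ω) ∂μ < ∞ := by
    intro t
    refine ((hX.identDistrib t 0).comp hW).lintegral_eq.trans_lt ?_
    refine lt_of_le_of_lt (lintegral_mono fun ω => ?_) hdom
    exact biSup_mono hBK
  refine ⟨fun y => (W y).toReal, hW.ennreal_toReal, fun t => ?_, ?_⟩
  · exact integrable_toReal_of_lintegral_ne_top (hW.comp (hX.1 t)).aemeasurable (hWint t).ne
  -- `toReal` sends `∞` to 0, so the bound by `b` is only valid where `W` is finite.
  · have hfin : ∀ᵐ ω ∂μ, ∀ t, W (X t ω) < ∞ :=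
      ae_all_iff.2 fun t => ae_lt_top (hW.comp (hX.1 t)) (hWint t).ne
    filter_upwards [hcont, hfin] with ω hω hfin t θ hθ
    rw [← toReal_enorm]
    exact ENNReal.toReal_mono (hfin t).ne
      (enorm_le_iSup_of_mem_closure (hω t) hBK hθ (hKB hθ))

/-- `D m` is the oscillation around `θ₀` on a shrinking neighbourhood. It tends to zero almost
surely by continuity and is dominated by `2 b`, hence its mean vanishes in the limit. -/
theorem IsStationaryErgodic.exists_modulus (hX : IsStationaryErgodic X μ)
    (hg : ∀ θ, Measurable (g θ))
    (hcont : ∀ᵐ ω ∂μ, ∀ t, ContinuousOn (fun θ => g θ (X t ω)) K) (hθ₀ : K ∈ 𝓝 θ₀)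
    (hdom : ∫⁻ ω, ⨆ θ ∈ K, ‖g θ (X 0 ω)‖ₑ ∂μ < ∞) :
    ∃ (D : ℕ → S → ℝ≥0∞) (V : ℕ → Set E), (∀ m, Measurable (D m)) ∧ (∀ m, V m ∈ 𝓝 θ₀) ∧
      Tendsto (fun m => ∫⁻ ω, D m (X 0 ω) ∂μ) atTop (𝓝 0) ∧
      ∀ᵐ ω ∂μ, ∀ t m, ∀ θ ∈ V m, ‖g θ (X t ω) - g θ₀ (X t ω)‖ₑ ≤ D m (X t ω) := by
  obtain ⟨b, hb, hbint, hbound⟩ := hX.exists_dominating hg hcont hdom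
  obtain ⟨B, hBK, hB, hKB⟩ := exists_countable_subset_subset_closure K
  -- Openness of `V m` matters: it makes `B ∩ V m` dense in `V m`, so the countable supremum
  -- controls the whole neighbourhood.
  set V : ℕ → Set E := fun m => Metric.ball θ₀ (1 / (m + 1 : ℝ)) ∩ interior K
  have hVo : ∀ m, IsOpen (V m) := fun m => Metric.isOpen_ball.inter isOpen_interior
  have hVK : ∀ m, V m ⊆ K := fun m => Set.inter_subset_right.trans interior_subset
  have hθ₀K : θ₀ ∈ K := mem_of_mem_nhds hθ₀
  set D : ℕ → S → ℝ≥0∞ := fun m y => ⨆ θ ∈ B ∩ V m, ‖g θ y - g θ₀ y‖ₑ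
  have hD : ∀ m, Measurable (D m) := fun m =>
    Measurable.biSup _ (hB.mono Set.inter_subset_left) fun θ _ => ((hg θ).sub (hg θ₀)).enorm
  refine ⟨D, V, hD, fun m => ?_, ?_, ?_⟩
  · exact Filter.inter_mem (Metric.ball_mem_nhds _ (by positivity)) (interior_mem_nhds.2 hθ₀)
  · have h0 : ∫⁻ _ : Ω, (0 : ℝ≥0∞) ∂μ = 0 := lintegral_zero
    rw [← h0]
    refine tendsto_lintegral_of_dominated_convergence
      (fun ω => ENNReal.ofReal (b (X 0 ω) + b (X 0 ω))) (fun m => (hD m).comp (hX.1 0)) ?_ ?_ ?_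
    · intro m
      filter_upwards [hbound] with ω hω
      refine iSup₂_le fun θ hθ => ?_
      rw [← ofReal_norm]
      refine ENNReal.ofReal_le_ofReal ((norm_sub_le _ _).trans ?_)
      exact add_le_add (hω 0 θ (hBK hθ.1)) (hω 0 θ₀ hθ₀K)
    · exact ((hbint 0).add (hbint 0)).lintegral_lt_top.ne
    · filter_upwards [hcont] with ω hω
      have hc : ContinuousAt (fun θ => g θ (X 0 ω)) θ₀ := (hω 0).continuousAt hθ₀
      rw [ENNReal.tendsto_nhds_zero]
      intro ε hε
      have hc' : Tendsto (fun θ => ‖g θ (X 0 ω) - g θ₀ (X 0 ω)‖ₑ) (𝓝 θ₀) (𝓝 0) := by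
        have := (hc.sub (continuousAt_const (y := g θ₀ (X 0 ω)))).enorm
        simpa [ContinuousAt] using this
      obtain ⟨r, hr, hball⟩ := Metric.eventually_nhds_iff_ball.1 (ENNReal.tendsto_nhds_zero.1 hc' ε hε)
      obtain ⟨M, hM⟩ := exists_nat_one_div_lt hr
      filter_upwards [eventually_ge_atTop M] with m hm
      refine iSup₂_le fun θ hθ => hball θ (Metric.ball_subset_ball ?_ hθ.2.1)
      exact (one_div_le_one_div_of_le (by positivity) (by gcongr)).trans hM.le
  · filter_upwards [hcont] with ω hω t m θ hθ
    refine enorm_le_iSup_of_mem_closure (h := fun θ => g θ (X t ω) - g θ₀ (X t ω))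
      ((hω t).sub continuousOn_const) (Set.inter_subset_left.trans hBK) (hVK m hθ) ?_
    rw [Set.inter_comm]
    exact (hVo m).inter_closure ⟨hθ, hKB (hVK m hθ)⟩

/-- A law of large numbers at a consistent estimator of the parameter. -/
theorem IsStationaryErgodic.tendstoInMeasure_average_estimator [IsProbabilityMeasure μ]
    (hX : IsStationaryErgodic X μ) (hg : ∀ θ, Measurable (g θ))
    (hcont : ∀ᵐ ω ∂μ, ∀ t, ContinuousOn (fun θ => g θ (X t ω)) K) (hθ₀ : K ∈ 𝓝 θ₀)
    (hdom : ∫⁻ ω, ⨆ θ ∈ K, ‖g θ (X 0 ω)‖ₑ ∂μ < ∞) {ϑ : ℕ → Ω → E}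
    (hϑ : ∀ V ∈ 𝓝 θ₀, Tendsto (fun T => μ {ω | ϑ T ω ∉ V}) atTop (𝓝 0)) (t : ℤ) :
    TendstoInMeasure μ
      (fun (T : ℕ) ω => (T : ℝ)⁻¹ * ∑ s ∈ Finset.Icc 1 T, g (ϑ T ω) (X (s : ℤ) ω)) atTop
      (fun _ => ∫ ω, g θ₀ (X t ω) ∂μ) := by
  obtain ⟨b, hb, hbint, hbound⟩ := hX.exists_dominating hg hcont hdom
  obtain ⟨D, V, hD, hV, hDlim, hDV⟩ := hX.exists_modulus hg hcont hθ₀ hdom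
  have hint : Integrable (fun ω => g θ₀ (X t ω)) μ := by
    refine (hbint t).mono' ((hg θ₀).comp (hX.1 t)).aestronglyMeasurable ?_
    filter_upwards [hbound] with ω hω using hω t θ₀ (mem_of_mem_nhds hθ₀)
  have hlln := hX.tendstoInMeasure_average (hg θ₀) t hint
  rw [tendstoInMeasure_iff_enorm] at hlln ⊢
  intro ε hε hε'
  have hε2 : 0 < ε / 2 := ENNReal.half_pos hε.ne'
  have hε2' : ε / 2 ≠ ∞ := (ENNReal.half_lt_self hε.ne' hε').ne_top
  have hDint : ∀ m (s : ℤ), ∫⁻ ω, D m (X s ω) ∂μ = ∫⁻ ω, D m (X 0 ω) ∂μ := fun m s =>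
    ((hX.identDistrib s 0).comp (hD m)).lintegral_eq
  -- A deviation of size `ε` needs a deviation at `θ₀` of size `ε / 2`, an estimator outside `V m`,
  -- or an average modulus of at least `ε / 2`. The last bound, from Markov and stationarity, does
  -- not depend on `T`.
  have hkey : ∀ (m T : ℕ), μ {ω | ε ≤ ‖(T : ℝ)⁻¹ * ∑ s ∈ Finset.Icc 1 T, g (ϑ T ω) (X (s : ℤ) ω)
        - ∫ ω, g θ₀ (X t ω) ∂μ‖ₑ} ≤
      μ {ω | ε / 2 ≤ ‖(T : ℝ)⁻¹ * ∑ s ∈ Finset.Icc 1 T, g θ₀ (X (s : ℤ) ω)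
        - ∫ ω, g θ₀ (X t ω) ∂μ‖ₑ} + μ {ω | ϑ T ω ∉ V m} +
      (∫⁻ ω, D m (X 0 ω) ∂μ) / (ε / 2) := by
    intro m T
    set Dav : Ω → ℝ≥0∞ := fun ω => (T : ℝ≥0∞)⁻¹ * ∑ s ∈ Finset.Icc 1 T, D m (X (s : ℤ) ω)
    have hsm : Measurable fun ω => ∑ s ∈ Finset.Icc 1 T, D m (X (s : ℤ) ω) :=
      Finset.measurable_sum _ fun s _ => (hD m).comp (hX.1 s)
    have hDavm : Measurable Dav := hsm.const_mul _
    have hDav : ∫⁻ ω, Dav ω ∂μ ≤ ∫⁻ ω, D m (X 0 ω) ∂μ := by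
      rw [lintegral_const_mul _ hsm, lintegral_finsetSum (f := fun (s : ℕ) ω => D m (X s ω)) _
          fun (s : ℕ) _ => (hD m).comp (hX.1 s)]
      simp only [hDint, Finset.sum_const, Nat.card_Icc, add_tsub_cancel_right, nsmul_eq_mul]
      rw [← mul_assoc]
      refine (mul_le_mul_left (ENNReal.inv_mul_le_one _) _).trans (one_mul _).le
    have hmarkov : μ {ω | ε / 2 ≤ Dav ω} ≤ (∫⁻ ω, D m (X 0 ω) ∂μ) / (ε / 2) :=
      (meas_ge_le_lintegral_div hDavm.aemeasurable hε2.ne' hε2').trans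
        (ENNReal.div_le_div_right hDav _)
    refine le_trans ?_ (add_le_add le_rfl hmarkov)
    refine le_trans ?_ ((add_le_add (measure_union_le _ _) le_rfl).trans' (measure_union_le _ _))
    refine measure_mono_ae ?_
    filter_upwards [hDV] with ω hω hε1
    by_contra hcon
    have h1 := not_le.1 fun h => hcon (Or.inl (Or.inl (Set.mem_ofPred.2 h)))
    have h2 : ϑ T ω ∈ V m := not_not.1 fun h => hcon (Or.inl (Or.inr h))
    have h3 := not_le.1 fun h => hcon (Or.inr (Set.mem_ofPred.2 h))
    have h4 : ‖(T : ℝ)⁻¹ * ∑ s ∈ Finset.Icc 1 T, g (ϑ T ω) (X (s : ℤ) ω) -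
        (T : ℝ)⁻¹ * ∑ s ∈ Finset.Icc 1 T, g θ₀ (X (s : ℤ) ω)‖ₑ ≤ Dav ω := by
      rw [← mul_sub, ← Finset.sum_sub_distrib, enorm_mul]
      rcases T.eq_zero_or_pos with rfl | hT
      · simp
      refine mul_le_mul' ?_ ?_
      · rw [enorm_inv (by positivity)]
        simp
      · exact (enorm_sum_le _ _).trans (Finset.sum_le_sum fun s _ => hω s m _ h2)
    refine absurd (hε1 : ε ≤ _) (not_le.2 ?_)
    calc _ = ‖((T : ℝ)⁻¹ * ∑ s ∈ Finset.Icc 1 T, g (ϑ T ω) (X (s : ℤ) ω) -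
        (T : ℝ)⁻¹ * ∑ s ∈ Finset.Icc 1 T, g θ₀ (X (s : ℤ) ω)) +
        ((T : ℝ)⁻¹ * ∑ s ∈ Finset.Icc 1 T, g θ₀ (X (s : ℤ) ω) - ∫ ω, g θ₀ (X t ω) ∂μ)‖ₑ := by
          rw [sub_add_sub_cancel]
      _ ≤ _ := enorm_add_le _ _
      _ < ε / 2 + ε / 2 := ENNReal.add_lt_add (h4.trans_lt h3) h1
      _ = ε := ENNReal.add_halves ε
  rw [ENNReal.tendsto_nhds_zero]
  intro η hη
  have hη3 : 0 < η / 3 := ENNReal.div_pos hη.ne' (by simp)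
  have hDlim' : Tendsto (fun m => (∫⁻ ω, D m (X 0 ω) ∂μ) / (ε / 2)) atTop (𝓝 0) := by
    have := ENNReal.Tendsto.div_const hDlim (b := ε / 2) (Or.inr hε2.ne')
    simpa using this
  -- The neighbourhood is fixed first; only then does `T` tend to infinity.
  obtain ⟨m, hm⟩ := (ENNReal.tendsto_nhds_zero.1 hDlim' _ hη3).exists
  filter_upwards [ENNReal.tendsto_nhds_zero.1 (hlln (ε / 2) hε2 hε2') _ hη3,
    ENNReal.tendsto_nhds_zero.1 (hϑ (V m) (hV m)) _ hη3] with T h1 h2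
  exact (hkey m T).trans ((add_le_add (add_le_add h1 h2) hm).trans (ENNReal.add_thirds η).le)

theorem IsStationaryErgodic.continuousAt_integral
    (hX : IsStationaryErgodic X μ) (hg : ∀ θ, Measurable (g θ))
    (hcont : ∀ᵐ ω ∂μ, ∀ t, ContinuousOn (fun θ => g θ (X t ω)) K) (hθ₀ : K ∈ 𝓝 θ₀)
    (hdom : ∫⁻ ω, ⨆ θ ∈ K, ‖g θ (X 0 ω)‖ₑ ∂μ < ∞) (t : ℤ) :
    ContinuousAt (fun θ => ∫ ω, g θ (X t ω) ∂μ) θ₀ := by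
  obtain ⟨b, hb, hbint, hbound⟩ := hX.exists_dominating hg hcont hdom
  refine continuousAt_of_dominated (bound := fun ω => b (X t ω))
    (Eventually.of_forall fun θ => ((hg θ).comp (hX.1 t)).aestronglyMeasurable) ?_ (hbint t) ?_
  · filter_upwards [hθ₀] with θ hθ
    filter_upwards [hbound] with ω hω using hω t θ hθ
  · filter_upwards [hcont] with ω hω using (hω t).continuousAt hθ₀

end UniformLaw

/-! ### Expectations with the estimator inside. -/

section RandomParameter

variable {Ω S E : Type*} [MeasurableSpace Ω] [MeasurableSpace S] {μ : Measure Ω}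
  {X : ℤ → Ω → S} [MetricSpace E] [SecondCountableTopology E] [MeasurableSpace E] [BorelSpace E]
  {g : E → S → ℝ} {K : Set E} {θ₀ : E}

/-- A Carathéodory function, continuous in the parameter and measurable in `ω`, is jointly
measurable. To have this for every `ω`, `h` is set to 0 on a null set and `ϑ` is replaced by a
measurable version with values in `K`. -/
theorem aestronglyMeasurable_comp_of_continuousOn {h : E → Ω → ℝ} (hK : MeasurableSet K)
    (hh : ∀ θ ∈ K, Measurable (h θ)) (hcont : ∀ᵐ ω ∂μ, ContinuousOn (fun θ => h θ ω) K)
    {ϑ : Ω → E} (hϑ : AEMeasurable ϑ μ) (hϑK : ∀ᵐ ω ∂μ, ϑ ω ∈ K) :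
    AEStronglyMeasurable (fun ω => h (ϑ ω) ω) μ := by
  classical
  rcases K.eq_empty_or_nonempty with rfl | ⟨θ₁, hθ₁⟩
  · have : μ = 0 := by simpa using hϑK
    simp [this]
  obtain ⟨N, hN, hNm, hN0⟩ := exists_measurable_superset_of_null (ae_iff.1 hcont)
  set u : K → Ω → ℝ := fun θ => Nᶜ.indicator (h θ)
  have hu : StronglyMeasurable (Function.uncurry u) := by
    refine stronglyMeasurable_uncurry_of_continuous_of_stronglyMeasurable ?_ ?_
    · intro ω
      by_cases hω : ω ∈ N
      · simpa [u, hω] using continuous_const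
      · have : ContinuousOn (fun θ => h θ ω) K := by
          by_contra hc
          exact hω (hN hc)
        simpa [u, hω, Set.domRestrict_def] using continuousOn_iff_continuous_domRestrict.1 this
    · intro θ
      exact ((hh θ θ.2).indicator hNm.compl).stronglyMeasurable
  have hmem : ∀ ω, (if hϑ.mk ϑ ω ∈ K then hϑ.mk ϑ ω else θ₁) ∈ K := fun ω => by
    split_ifs with h
    exacts [h, hθ₁]
  set ϑ' : Ω → K := fun ω => ⟨if hϑ.mk ϑ ω ∈ K then hϑ.mk ϑ ω else θ₁, hmem ω⟩
  have hϑ' : Measurable ϑ' :=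
    (Measurable.ite (hϑ.measurable_mk hK) hϑ.measurable_mk measurable_const).subtype_mk
  refine ⟨fun ω => u (ϑ' ω) ω, hu.comp_measurable (hϑ'.prodMk measurable_id), ?_⟩
  filter_upwards [hϑ.ae_eq_mk, hϑK, compl_mem_ae_iff.2 hN0] with ω h1 h2 h3
  have h4 : hϑ.mk ϑ ω ∈ K := h1 ▸ h2
  simp only [u, ϑ', h4, if_true, Set.indicator_of_mem h3]
  rw [h1]

theorem IsStationaryErgodic.tendsto_integral_estimator
    (hX : IsStationaryErgodic X μ) (hg : ∀ θ, Measurable (g θ)) (hK : MeasurableSet K)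
    (hcont : ∀ᵐ ω ∂μ, ∀ t, ContinuousOn (fun θ => g θ (X t ω)) K) (hθ₀ : K ∈ 𝓝 θ₀)
    (hdom : ∫⁻ ω, ⨆ θ ∈ K, ‖g θ (X 0 ω)‖ₑ ∂μ < ∞) {ϑ : ℕ → Ω → E}
    (hϑm : ∀ T, AEMeasurable (ϑ T) μ) (hϑ : ∀ᵐ ω ∂μ, Tendsto (fun T => ϑ T ω) atTop (𝓝 θ₀))
    (hϑK : ∀ᶠ T in atTop, ∀ᵐ ω ∂μ, ϑ T ω ∈ K) (t : ℤ) :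
    (∀ᶠ T in atTop, Integrable (fun ω => g (ϑ T ω) (X t ω)) μ) ∧
      Tendsto (fun T => ∫ ω, g (ϑ T ω) (X t ω) ∂μ) atTop (𝓝 (∫ ω, g θ₀ (X t ω) ∂μ)) := by
  obtain ⟨b, hb, hbint, hbound⟩ := hX.exists_dominating hg hcont hdom
  have hmeas : ∀ᶠ T in atTop, AEStronglyMeasurable (fun ω => g (ϑ T ω) (X t ω)) μ := by
    filter_upwards [hϑK] with T hT
    exact aestronglyMeasurable_comp_of_continuousOn (h := fun θ ω => g θ (X t ω)) hK
      (fun θ _ => (hg θ).comp (hX.1 t)) (hcont.mono fun ω hω => hω t) (hϑm T) hT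
  have hle : ∀ᶠ T in atTop, ∀ᵐ ω ∂μ, ‖g (ϑ T ω) (X t ω)‖ ≤ b (X t ω) := by
    filter_upwards [hϑK] with T hT
    filter_upwards [hT, hbound] with ω h1 h2 using h2 t _ h1
  refine ⟨?_, tendsto_integral_filter_of_dominated_convergence _ hmeas hle (hbint t) ?_⟩
  · filter_upwards [hmeas, hle] with T h1 h2 using (hbint t).mono' h1 h2
  · filter_upwards [hcont, hϑ] with ω h1 h2
    exact ((h1 t).continuousAt hθ₀).tendsto.comp h2

end RandomParameter

end GenericMLE

namespace GenericMLE

/-! ### Calculus of convergence in probability. -/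

section ConvergenceInProbability

variable {Ω : Type*} [MeasurableSpace Ω] {μ : Measure Ω}

/-- In neighbourhood form, continuous mapping is a preimage argument and joint convergence a union
bound; neither needs measurability. -/
theorem tendstoInMeasure_const_iff_nhds {F : Type*} [PseudoEMetricSpace F] {A : ℕ → Ω → F} {a : F} :
    TendstoInMeasure μ A atTop (fun _ => a) ↔
      ∀ V ∈ 𝓝 a, Tendsto (fun T => μ {ω | A T ω ∉ V}) atTop (𝓝 0) := by
  constructor
  · intro h V hV
    obtain ⟨r, hr, hrV⟩ := EMetric.mem_nhds_iff.1 hV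
    refine tendsto_of_tendsto_of_tendsto_of_le_of_le tendsto_const_nhds (h r hr)
      (fun _ => zero_le) fun T => measure_mono fun ω hω => ?_
    by_contra hc
    exact hω (hrV (Metric.mem_eball.2 (not_le.1 fun h => hc (Set.mem_ofPred.2 h))))
  · intro h r hr
    refine (h _ (Metric.eball_mem_nhds a hr)).congr fun T => congrArg μ ?_
    ext ω
    simp

theorem tendsto_measure_notMem_comp {F G : Type*} [TopologicalSpace F] [TopologicalSpace G]
    {A : ℕ → Ω → F} {a : F} (hA : ∀ V ∈ 𝓝 a, Tendsto (fun T => μ {ω | A T ω ∉ V}) atTop (𝓝 0))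
    {φ : F → G} (hφ : ContinuousAt φ a) :
    ∀ V ∈ 𝓝 (φ a), Tendsto (fun T => μ {ω | φ (A T ω) ∉ V}) atTop (𝓝 0) :=
  fun _ hV => hA _ (hφ hV)

theorem tendsto_measure_notMem_pi {ι : Type*} [Finite ι] {F : ι → Type*}
    [∀ i, TopologicalSpace (F i)] {A : ℕ → Ω → ∀ i, F i} {a : ∀ i, F i}
    (hA : ∀ i, ∀ V ∈ 𝓝 (a i), Tendsto (fun T => μ {ω | A T ω i ∉ V}) atTop (𝓝 0)) :
    ∀ V ∈ 𝓝 a, Tendsto (fun T => μ {ω | A T ω ∉ V}) atTop (𝓝 0) := by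
  classical
  intro V hV
  have := Fintype.ofFinite ι
  rw [nhds_pi, Filter.mem_pi'] at hV
  obtain ⟨I, W, hW, hWV⟩ := hV
  have hsum : Tendsto (fun T => ∑ i ∈ I, μ {ω | A T ω i ∉ W i}) atTop (𝓝 0) := by
    have := tendsto_finsetSum I fun i _ => hA i (W i) (hW i)
    simpa using this
  refine tendsto_of_tendsto_of_tendsto_of_le_of_le tendsto_const_nhds hsum
    (fun _ => zero_le) fun T => ?_
  refine le_trans (measure_mono ?_) (measure_biUnion_finset_le I _)
  intro ω hω
  by_contra hc
  refine hω (hWV fun i hi => ?_)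
  by_contra hi'
  exact hc (Set.mem_biUnion hi hi')

theorem tendstoInMeasure_sub {A A' : ℕ → Ω → ℝ} {a a' : ℝ}
    (hA : TendstoInMeasure μ A atTop (fun _ => a))
    (hA' : TendstoInMeasure μ A' atTop (fun _ => a')) :
    TendstoInMeasure μ (fun T ω => A T ω - A' T ω) atTop (fun _ => a - a') := by
  rw [tendstoInMeasure_const_iff_nhds] at hA hA' ⊢
  have hpair := tendsto_measure_notMem_pi (μ := μ) (ι := Fin 2) (F := fun _ => ℝ)
    (A := fun T ω => ![A T ω, A' T ω]) (a := ![a, a'])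
    (Fin.forall_fin_two.2 ⟨by simpa using hA, by simpa using hA'⟩)
  have hφ : Continuous fun x : Fin 2 → ℝ => x 0 - x 1 := by fun_prop
  simpa using tendsto_measure_notMem_comp hpair hφ.continuousAt

theorem tendstoInMeasure_of_tendsto_const {m : ℕ → ℝ} {a : ℝ} (hm : Tendsto m atTop (𝓝 a)) :
    TendstoInMeasure μ (fun T _ => m T) atTop (fun _ => a) := by
  rw [tendstoInMeasure_const_iff_nhds]
  intro V hV
  refine tendsto_const_nhds.congr' ?_
  filter_upwards [hm hV] with T hT
  have : m T ∈ V := hT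
  simp [this]

/-- Needed because the estimator lies in `Θ₀` only with probability tending to one. -/
theorem tendstoInMeasure_of_ae_eq_on {F : Type*} [PseudoEMetricSpace F] {A A' : ℕ → Ω → F} {a : F}
    (hA : TendstoInMeasure μ A atTop (fun _ => a)) {N : ℕ → Set Ω}
    (hN : Tendsto (fun T => μ (N T)) atTop (𝓝 0))
    (hAA' : ∀ T, ∀ᵐ ω ∂μ, ω ∉ N T → A' T ω = A T ω) :
    TendstoInMeasure μ A' atTop (fun _ => a) := by
  intro r hr
  have hlim : Tendsto (fun T => μ {ω | r ≤ edist (A T ω) a} + μ (N T)) atTop (𝓝 0) := by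
    simpa using (hA r hr).add hN
  refine tendsto_of_tendsto_of_tendsto_of_le_of_le tendsto_const_nhds hlim
    (fun _ => zero_le) fun T => le_trans (measure_mono_ae ?_) (measure_union_le _ _)
  filter_upwards [hAA' T] with ω hω hr'
  by_cases h : ω ∈ N T
  · exact Or.inr h
  · exact Or.inl (Set.mem_ofPred.2 (hω h ▸ hr' : r ≤ edist (A T ω) a))

/-- By the adjugate formula, each entry of the inverse is continuous wherever the determinant is
nonzero. The formula also holds at singular matrices, where both sides are 0. -/
theorem tendstoInProbability_inv {k : ℕ} {A : ℕ → Ω → Matrix (Fin k) (Fin k) ℝ}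
    {A₀ : Matrix (Fin k) (Fin k) ℝ} (hA : TendstoInProbability μ A A₀) (hA₀ : IsUnit A₀.det) :
    TendstoInProbability μ (fun T ω => (A T ω)⁻¹) A₀⁻¹ := by
  intro i j
  rw [tendstoInMeasure_const_iff_nhds]
  have hA' := tendsto_measure_notMem_pi (μ := μ) (F := fun _ : Fin k => Fin k → ℝ) (A := A)
    (a := A₀) fun i => tendsto_measure_notMem_pi (F := fun _ : Fin k => ℝ)
      fun j => tendstoInMeasure_const_iff_nhds.1 (hA i j)
  have hφ : ContinuousAt
      (fun B : Fin k → Fin k → ℝ => (Matrix.det B)⁻¹ * Matrix.adjugate B i j) A₀ := by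
    refine ContinuousAt.mul (ContinuousAt.inv₀ ?_ hA₀.ne_zero) ?_
    · exact (Continuous.matrix_det continuous_id).continuousAt
    · exact ((Continuous.matrix_adjugate continuous_id).matrix_elem i j).continuousAt
  have hinv : ∀ B : Matrix (Fin k) (Fin k) ℝ, B⁻¹ i j = (Matrix.det B)⁻¹ * Matrix.adjugate B i j := by
    intro B
    simp [Matrix.inv_def]
  simp only [hinv]
  exact tendsto_measure_notMem_comp hA' hφ

end ConvergenceInProbability

/-! ### The score as a functional of the residual path. -/

section ScoreFunctional

variable {Ω : Type*} {n k : ℕ}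
  (f : EuclideanSpace ℝ (Fin n) → EuclideanSpace ℝ (Fin k) → ℝ)
  (Θ : Set (EuclideanSpace ℝ (Fin k)))

open Classical in
/-- The log-likelihood contribution as a function of the residual path `y`, set to `0` off `Θ`. -/
noncomputable def pathContribution (y : Θ → EuclideanSpace ℝ (Fin n))
    (θ : EuclideanSpace ℝ (Fin k)) : ℝ :=
  if h : θ ∈ Θ then Real.log (f (y ⟨θ, h⟩) θ) else 0

/-- The score as a measurable function of the residual path `y`. -/
noncomputable def pathScore (θ : EuclideanSpace ℝ (Fin k)) (i : Fin k)
    (y : Θ → EuclideanSpace ℝ (Fin n)) : ℝ :=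
  limsup (fun m : ℕ => (m : ℝ) * (pathContribution f Θ y
    (θ + (m : ℝ)⁻¹ • EuclideanSpace.single i 1) - pathContribution f Θ y θ)) atTop

variable {f Θ}

theorem measurable_pathContribution (hf : IsDensityFamily f Θ) (θ : EuclideanSpace ℝ (Fin k)) :
    Measurable fun y => pathContribution f Θ y θ := by
  unfold pathContribution
  by_cases h : θ ∈ Θ
  · simp only [h, dite_true]
    exact Real.measurable_log.comp ((hf θ h).1.comp (measurable_pi_apply _))
  · simp [h]

theorem measurable_pathScore (hf : IsDensityFamily f Θ) (θ : EuclideanSpace ℝ (Fin k))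
    (i : Fin k) : Measurable (pathScore f Θ θ i) :=
  Measurable.limsup fun m => ((measurable_pathContribution hf _).sub
    (measurable_pathContribution hf θ)).const_mul (m : ℝ)

variable {ε : ℤ → EuclideanSpace ℝ (Fin k) → Ω → EuclideanSpace ℝ (Fin n)}
  {U : Set (EuclideanSpace ℝ (Fin k))} {t : ℤ} {ω : Ω}

/-- The difference quotients along `e_i` with step `1 / m` converge to the partial derivative, so
the limsup, chosen for its unconditional measurability, is a limit. -/
theorem score_apply_eq_pathScore (hU : IsOpen U) (hUΘ : U ⊆ Θ)
    (hl : ContDiffOn ℝ 2 (contribution f ε t ω) U) {θ : EuclideanSpace ℝ (Fin k)} (hθ : θ ∈ U)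
    (i : Fin k) :
    score f ε t ω θ i = pathScore f Θ θ i (fun η : Θ => ε t η ω) := by
  have hd : DifferentiableAt ℝ (contribution f ε t ω) θ :=
    (hl.contDiffAt (hU.mem_nhds hθ)).differentiableAt (by norm_num)
  have heq : pathContribution f Θ (fun η : Θ => ε t η ω) =ᶠ[𝓝 θ] contribution f ε t ω := by
    filter_upwards [hU.mem_nhds hθ] with η hη
    simp [pathContribution, contribution, hUΘ hη]
  have hlim := (hd.hasFDerivAt.congr_of_eventuallyEq heq).lim (EuclideanSpace.single i (1 : ℝ))
    (c := fun m : ℕ => (m : ℝ)) (l := atTop)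
    (by simpa using tendsto_natCast_atTop_atTop (R := ℝ))
  have hgrad : score f ε t ω θ i =
      fderiv ℝ (contribution f ε t ω) θ (EuclideanSpace.single i (1 : ℝ)) := by
    rw [score, gradient, ← InnerProductSpace.toDual_symm_apply, EuclideanSpace.inner_single_right]
    simp
  rw [hgrad]
  exact hlim.limsup_eq.symm

theorem continuousOn_score (hU : IsOpen U) (hl : ContDiffOn ℝ 2 (contribution f ε t ω) U) :
    ContinuousOn (score f ε t ω) U :=
  (InnerProductSpace.toDual ℝ _).symm.continuous.comp_continuousOn
    (hl.continuousOn_fderiv_of_isOpen hU (by norm_num))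

end ScoreFunctional

end GenericMLE

/-! ### Assembly of the theorem. -/

open GenericMLE in
theorem theorem3
    {Ω : Type*} [mΩ : MeasurableSpace Ω] (μ : Measure Ω) [IsProbabilityMeasure μ]
    {n k : ℕ}
    -- parameter space, true parameter, family of densities, residuals, estimators
    (Θ : Set (EuclideanSpace ℝ (Fin k)))
    (θ₀ : EuclideanSpace ℝ (Fin k))
    (f : EuclideanSpace ℝ (Fin n) → EuclideanSpace ℝ (Fin k) → ℝ)
    (ε : ℤ → EuclideanSpace ℝ (Fin k) → Ω → EuclideanSpace ℝ (Fin n))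
    (θhat : ℕ → Ω → EuclideanSpace ℝ (Fin k))
    -- `U` is the open neighbourhood of `θ₀` on which the contributions are smooth
    (U : Set (EuclideanSpace ℝ (Fin k))) (hU : IsOpen U) (hUΘ : U ⊆ Θ)
    -- `Θ₀` is the compact set on which the suprema are taken
    (Θ₀ : Set (EuclideanSpace ℝ (Fin k))) (hΘ₀c : IsCompact Θ₀) (hΘ₀n : Θ₀.Nontrivial)
    (hΘ₀U : Θ₀ ⊆ U) (hθΘ₀ : θ₀ ∈ interior Θ₀)
    -- (1) consistent approximate solutions of the first order condition
    (hθ₀ : θ₀ ∈ interior Θ)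
    (hhat_mem : ∀ T ω, θhat T ω ∈ Θ)
    (hhat_meas : ∀ T, AEMeasurable (θhat T) μ)
    (hhat_lim : ∀ᵐ ω ∂μ, Tendsto (fun T => θhat T ω) atTop (𝓝 θ₀))
    (hhat_foc : TendstoInMeasure μ
      (fun (T : ℕ) ω => √(T : ℝ) • gradient (logLikelihood f ε T ω) (θhat T ω)) atTop
      (fun _ => (0 : EuclideanSpace ℝ (Fin k))))
    -- (2) stationary ergodic residuals, with density `f(·, θ₀)` at the true parameter
    (hstat : IsStationaryErgodic (fun t ω (θ : Θ) => ε t θ ω) μ)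
    (hdens : ∀ t, μ.map (ε t θ₀) = volume.withDensity (fun x => ENNReal.ofReal (f x θ₀)))
    -- (3) the score at the true parameter is a martingale difference sequence
    (ℱ : Filtration ℤ mΩ)
    (hmds : IsMartingaleDifference (fun t ω => score f ε t ω θ₀) ℱ μ)
    -- (4) positive densities, twice continuously differentiable contributions
    (hf : IsDensityFamily f Θ)
    (hfpos : ∀ x, ∀ θ ∈ Θ, 0 < f x θ)
    (hfsmooth : ∀ x, ContDiffOn ℝ 2 (f x) U)
    (hlsmooth : ∀ᵐ ω ∂μ, ∀ t, ContDiffOn ℝ 2 (contribution f ε t ω) U)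
    -- (5) square integrable score at the true parameter
    (hscore : ∀ t, MemLp (fun ω => score f ε t ω θ₀) 2 μ)
    -- (6) dominated Hessian
    (hhess : ∀ t, ∫⁻ ω, ⨆ θ ∈ Θ₀, ‖scoreHessian f ε t ω θ‖ₑ ∂μ < ∞)
    -- (7) nonsingular expected Hessian
    (hnonsing : ∀ t, IsUnit (matrixMean μ (fun ω => scoreHessian f ε t ω θ₀)).det)
    -- (8) information matrix equality
    (hinfo : ∀ t, matrixMean μ (fun ω => scoreHessian f ε t ω θ₀) = -expectedOPG f ε μ t θ₀)
    -- the additional condition: dominated squared score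
    (hdom : ∀ t, ∫⁻ ω, (⨆ θ ∈ Θ₀, ‖score f ε t ω θ‖ₑ) ^ 2 ∂μ < ∞) :
    -- the expected outer products are finite on `Θ₀` and do not depend on `t`
    (∀ t, ∀ θ ∈ Θ₀, MatrixIntegrable μ (fun ω => outer (score f ε t ω θ))) ∧
    (∀ s t, ∀ θ ∈ Θ₀, expectedOPG f ε μ s θ = expectedOPG f ε μ t θ) ∧
    -- convergence to the expected outer product at the true parameter
    (∀ t, TendstoInProbability μ (fun T ω => scoreOPG f ε T ω (θhat T ω))
      (expectedOPG f ε μ t θ₀)) ∧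
    -- the same with the limit `θ ↦ E[l_{θ,t}(θ) l_{θ,t}(θ)']` evaluated at the estimator
    (∀ t, TendstoInProbability μ
      (fun T ω => scoreOPG f ε T ω (θhat T ω) - expectedOPG f ε μ t (θhat T ω)) 0) ∧
    -- the same with the estimator inside the expectation, for estimators with values in `Θ₀`
    (∀ t, (∀ᶠ T in atTop, ∀ᵐ ω ∂μ, θhat T ω ∈ Θ₀) →
      (∀ᶠ T in atTop, MatrixIntegrable μ (fun ω => outer (score f ε t ω (θhat T ω)))) ∧
      TendstoInProbability μ
        (fun T ω => scoreOPG f ε T ω (θhat T ω) -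
          matrixMean μ (fun ω' => outer (score f ε t ω' (θhat T ω')))) 0) ∧
    -- consistent estimation of the asymptotic covariance matrix
    (∀ t, IsUnit (expectedOPG f ε μ t θ₀).det ∧
      TendstoInProbability μ (fun T ω => (scoreOPG f ε T ω (θhat T ω))⁻¹)
        (expectedOPG f ε μ t θ₀)⁻¹) := by
  have hθ₀K : Θ₀ ∈ 𝓝 θ₀ := mem_interior_iff_mem_nhds.1 hθΘ₀
  set X : ℤ → Ω → Θ → EuclideanSpace ℝ (Fin n) := fun t ω θ => ε t θ ω
  set g : Fin k → Fin k → EuclideanSpace ℝ (Fin k) → (Θ → EuclideanSpace ℝ (Fin n)) → ℝ :=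
    fun i j θ y => pathScore f Θ θ i y * pathScore f Θ θ j y with hg_def
  have hg : ∀ i j θ, Measurable (g i j θ) := fun i j θ =>
    (measurable_pathScore hf θ i).mul (measurable_pathScore hf θ j)
  have hrep : ∀ᵐ ω ∂μ, ∀ t, ∀ θ ∈ Θ₀, ∀ i j, outer (score f ε t ω θ) i j = g i j θ (X t ω) := by
    filter_upwards [hlsmooth] with ω hω t θ hθ i j
    simp only [outer, Matrix.of_apply, hg_def]
    rw [score_apply_eq_pathScore hU hUΘ (hω t) (hΘ₀U hθ) i,
      score_apply_eq_pathScore hU hUΘ (hω t) (hΘ₀U hθ) j]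
  have hcont : ∀ i j, ∀ᵐ ω ∂μ, ∀ t, ContinuousOn (fun θ => g i j θ (X t ω)) Θ₀ := by
    intro i j
    filter_upwards [hlsmooth, hrep] with ω hω hrω t
    have hs := (continuousOn_score hU (hω t)).mono hΘ₀U
    have hsi : ∀ i, ContinuousOn (fun θ => score f ε t ω θ i) Θ₀ := fun i =>
      (EuclideanSpace.proj (𝕜 := ℝ) i).continuous.comp_continuousOn hs
    refine ((hsi i).mul (hsi j)).congr fun θ hθ => ?_
    exact (hrω t θ hθ i j).symm
  -- Each coordinate is at most the norm, so a product of two is at most the squared supremum in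
  -- `hdom`.
  have hbdd : ∀ i j, ∫⁻ ω, ⨆ θ ∈ Θ₀, ‖g i j θ (X 0 ω)‖ₑ ∂μ < ∞ := by
    intro i j
    refine lt_of_le_of_lt (lintegral_mono_ae ?_) (hdom 0)
    filter_upwards [hrep] with ω hω
    refine iSup₂_le fun θ hθ => ?_
    have hle : ∀ i, ‖score f ε 0 ω θ i‖ₑ ≤ ⨆ θ ∈ Θ₀, ‖score f ε 0 ω θ‖ₑ := by
      intro i
      refine le_trans ?_ (le_iSup₂_of_le θ hθ le_rfl)
      exact enorm_le_iff_norm_le.2 (PiLp.norm_apply_le _ i)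
    rw [← hω 0 θ hθ i j, outer, Matrix.of_apply, enorm_mul, sq]
    exact mul_le_mul' (hle i) (hle j)
  have hint : ∀ i j t, ∀ θ ∈ Θ₀, Integrable (fun ω => g i j θ (X t ω)) μ := by
    intro i j t θ hθ
    obtain ⟨b, -, hbint, hb⟩ := hstat.exists_dominating (hg i j) (hcont i j) (hbdd i j)
    refine (hbint t).mono' ((hg i j θ).comp (hstat.1 t)).aestronglyMeasurable ?_
    filter_upwards [hb] with ω hω using hω t θ hθ
  have hmean : ∀ i j t, ∀ θ ∈ Θ₀, expectedOPG f ε μ t θ i j = ∫ ω, g i j θ (X t ω) ∂μ := by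
    intro i j t θ hθ
    exact integral_congr_ae (hrep.mono fun ω hω => hω t θ hθ i j)
  have hnhds : ∀ V ∈ 𝓝 θ₀, Tendsto (fun T => μ {ω | θhat T ω ∉ V}) atTop (𝓝 0) :=
    tendstoInMeasure_const_iff_nhds.1
      (tendstoInMeasure_of_tendsto_ae (fun T => (hhat_meas T).aestronglyMeasurable) hhat_lim)
  have hB : ∀ t, TendstoInProbability μ (fun T ω => scoreOPG f ε T ω (θhat T ω))
      (expectedOPG f ε μ t θ₀) := by
    intro t i j
    rw [hmean i j t θ₀ (mem_of_mem_nhds hθ₀K)]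
    refine tendstoInMeasure_of_ae_eq_on (hstat.tendstoInMeasure_average_estimator (hg i j)
      (hcont i j) hθ₀K (hbdd i j) hnhds t) (hnhds Θ₀ hθ₀K) fun T => ?_
    filter_upwards [hrep] with ω hω hT
    have hT' : θhat T ω ∈ Θ₀ := not_not.1 fun h => hT (Set.mem_ofPred.2 h)
    simp only [scoreOPG, Matrix.smul_apply, Matrix.sum_apply, smul_eq_mul, hω _ _ hT']
  have hdet : ∀ t, IsUnit (expectedOPG f ε μ t θ₀).det := by
    intro t
    have h := hnonsing t
    rw [hinfo t] at h
    rw [← Matrix.isUnit_iff_isUnit_det] at h ⊢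
    exact IsUnit.neg_iff _ |>.1 h
  refine ⟨fun t θ hθ i j => ?_, fun s t θ hθ => ?_, hB, fun t i j => ?_, fun t hmem => ?_,
    fun t => ⟨hdet t, tendstoInProbability_inv (hB t) (hdet t)⟩⟩
  · exact (hint i j t θ hθ).congr (hrep.mono fun ω hω => (hω t θ hθ i j).symm)
  · ext i j
    rw [hmean i j s θ hθ, hmean i j t θ hθ]
    exact ((hstat.identDistrib s t).comp (hg i j θ)).integral_eq
  -- Both terms of the difference converge to the same limit, the second by continuity at `θ₀`;
  -- values off `Θ₀` are irrelevant.
  · have hM : ContinuousAt (fun θ => expectedOPG f ε μ t θ i j) θ₀ := by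
      refine (hstat.continuousAt_integral (hg i j) (hcont i j) hθ₀K (hbdd i j) t).congr ?_
      filter_upwards [hθ₀K] with θ hθ using (hmean i j t θ hθ).symm
    have := tendstoInMeasure_sub (hB t i j)
      (tendstoInMeasure_const_iff_nhds.2 (tendsto_measure_notMem_comp hnhds hM))
    simpa using this
  · have hlim := fun i j => hstat.tendsto_integral_estimator (hg i j) hΘ₀c.measurableSet (hcont i j)
      hθ₀K (hbdd i j) hhat_meas hhat_lim hmem t
    have hrepT : ∀ᶠ T in atTop, ∀ᵐ ω ∂μ, ∀ i j,
        outer (score f ε t ω (θhat T ω)) i j = g i j (θhat T ω) (X t ω) := by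
      filter_upwards [hmem] with T hT
      filter_upwards [hT, hrep] with ω h1 h2 using h2 t _ h1
    refine ⟨?_, fun i j => ?_⟩
    · filter_upwards [hrepT, eventually_all.2 fun i => eventually_all.2 fun j => (hlim i j).1]
        with T h1 h2 i j
      exact (h2 i j).congr (h1.mono fun ω hω => (hω i j).symm)
    · have hm : Tendsto (fun T => ∫ ω, outer (score f ε t ω (θhat T ω)) i j ∂μ) atTop
          (𝓝 (expectedOPG f ε μ t θ₀ i j)) := by
        rw [hmean i j t θ₀ (mem_of_mem_nhds hθ₀K)]
        refine (hlim i j).2.congr' ?_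
        filter_upwards [hrepT] with T hT
        exact integral_congr_ae (hT.mono fun ω hω => (hω i j).symm)
      have := tendstoInMeasure_sub (hB t i j) (tendstoInMeasure_of_tendsto_const hm)
      simpa [matrixMean] using this
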